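/- **Proposition 6.1.** A subset $U$ of a topological space $X$ is called ambiently contractible if the inclusion $U\to X$ is nullhomotopic. A cover $\{U_\alpha\}_{\alpha\in A}$ of $X$ is called numerable if there is a partition of unity $\{f_\alpha\}_{\alpha\in A}$ on $X$ whose supports $\operatorname{Supp}(f_\alpha)=\overline{f_\alpha^{-1}((0,1])}$ form a locally finite family with $\operatorname{Supp}(f_\alpha)\subset U_\alpha$ for all $\alpha$. A Dold space is a topological space that admits a numerable cover by ambiently contractible subsets. There are Dold spaces which are not of the homotopy type of a CW-complex. Explicitly, let $$Y=\{0\}\cup\{1/n : n\in\mathbb{N},\ n\ge 1\}\subset\mathbb{R}$$ with the subspace topology, and let $\widehat\Sigma Y$ be its unreduced suspension, i.e. the quotient of $Y\times[0,1]$ in which $Y\times\{0\}$ and $Y\times\{1\}$ are each collapsed to a point. Then 1. $\widehat\Sigma Y$ is a Dold space; 2. $\widehat\Sigma Y$ is not homotopy equivalent to any CW-complex; 3. $\widehat\Sigma Y$ is compact; 4. the singular homology group $H_1(\widehat\Sigma Y;\mathbb{Z})$ is not finitely generated. -/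

import Mathlib

universe u v

open scoped unitInterval

/-- A subset `A` of a space `X` is ambiently contractible if the inclusion `A → X` is
nullhomotopic, i.e. homotopic to a constant map. -/
def IsAmbientlyContractible {X : Type u} [TopologicalSpace X] (A : Set X) : Prop :=
  (⟨Subtype.val, continuous_subtype_val⟩ : C(A, X)).Nullhomotopic

/-- A family of subsets of `X` is a numerable cover if it has a numeration: a partition of unity
`f` on `X` with locally finite supports such that the (closed) support of each `f i` is contained
in `U i`. Such a family automatically covers `X`. -/
def IsNumerableCover {X : Type u} [TopologicalSpace X] {ι : Type u} (U : ι → Set X) : Prop :=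
  ∃ f : PartitionOfUnity ι X, f.IsSubordinate U

/-- A Dold space (numerably contractible space) is a space with a numerable cover by ambiently
contractible subsets. -/
def IsDoldSpace (X : Type u) [TopologicalSpace X] : Prop :=
  ∃ (ι : Type u) (U : ι → Set X), IsNumerableCover U ∧ ∀ i, IsAmbientlyContractible (U i)

/-- `X` has the homotopy type of a (Hausdorff) CW-complex. The universe of the CW-complex is
arbitrary. -/
def HasCWHomotopyType (X : Type u) [TopologicalSpace X] : Prop :=
  ∃ (Z : Type v) (_ : TopologicalSpace Z), T2Space Z ∧
    Nonempty (Topology.CWComplex (Set.univ : Set Z)) ∧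
    Nonempty (ContinuousMap.HomotopyEquiv X Z)

/-- The identifications defining the unreduced suspension: the bottom `X × {0}` is glued to the
point `false`, the top `X × {1}` to the point `true`. -/
inductive SuspensionRel (X : Type u) : (X × I) ⊕ Bool → (X × I) ⊕ Bool → Prop
  | bottom (x : X) : SuspensionRel X (Sum.inl (x, 0)) (Sum.inr false)
  | top (x : X) : SuspensionRel X (Sum.inl (x, 1)) (Sum.inr true)

/-- The unreduced suspension of `X`: the double mapping cylinder of `pt ← X → pt`. -/
def UnreducedSuspension (X : Type u) : Type u := Quot (SuspensionRel X)

/-- The quotient topology. -/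
instance (X : Type u) [TopologicalSpace X] : TopologicalSpace (UnreducedSuspension X) :=
  inferInstanceAs (TopologicalSpace (Quot (SuspensionRel X)))

/-- The subset `{0} ∪ {1/n : n ≥ 1}` of the real line. -/
def harmonicSet : Set ℝ := {0} ∪ {y | ∃ n : ℕ, 1 ≤ n ∧ y = 1 / (n : ℝ)}

/-- The first singular homology group of `X` with integer coefficients. -/
noncomputable def integralH1 (X : Type u) [TopologicalSpace X] : ModuleCat.{u} ℤ :=
  ((AlgebraicTopology.singularHomologyFunctor (ModuleCat.{u} ℤ) 1).obj
    (ModuleCat.of ℤ (ULift.{u} ℤ))).obj (TopCat.of X)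

open Set Filter Topology

/-! ### Lifting circle-valued maps -/

/-! Everything rests on `meridianWinding S`, which turns once along each meridian over `S` and is
constant on the others. Over a clopen `S` it is continuous. Over any `S` it becomes continuous after
composition with a map from a locally connected space, because such a map cannot jump between
meridians of a totally disconnected base away from the poles.

No CW type: let `S` omit only an accumulation point `y₀`. Given an equivalence with a CW complex,
composing the winding with the round trip through the complex yields a continuous `k`. The homotopy
from the round trip to the identity sweeps a square over each meridian. The paths of the poles are
common to all squares, so the angle of `k` along the meridian at `y ≠ y₀` exceeds that at `y₀` by a
full turn. Continuity of `k` and compactness of `I` allow less than half a turn near `y₀`.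

Homology: angle variation is a singular cocycle. Windings over isolated points pair diagonally with
differences of meridians, giving infinitely many independent classes.

The Dold property uses two overlapping cones, each contracted by sliding along meridians. -/

theorem exists_circle_lift {A : Type*} [TopologicalSpace A] [SimplyConnectedSpace A]
    [LocallyPathConnectedSpace A] (γ : C(A, Circle)) :
    ∃ θ : C(A, ℝ), ∀ x, Circle.exp (θ x) = γ x := by
  obtain ⟨a⟩ : Nonempty A := inferInstance
  obtain ⟨θ, ⟨-, hθ⟩, -⟩ := Circle.isCoveringMap_exp.existsUnique_continuousMap_lifts γ a
    (γ a : ℂ).arg (Circle.exp_arg _)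
  exact ⟨θ, congrFun hθ⟩

theorem circle_lift_sub_eq {A : Type*} [TopologicalSpace A] [PreconnectedSpace A] {θ θ' : A → ℝ}
    (hθ : Continuous θ) (hθ' : Continuous θ')
    (h : ∀ x, Circle.exp (θ x) = Circle.exp (θ' x)) (a b : A) :
    θ b - θ a = θ' b - θ' a := by
  have := Circle.isCoveringMap_exp.const_of_comp (hθ.sub hθ')
    (fun x y ↦ by simp [h]) a b
  simp only [Pi.sub_apply] at this
  linarith

open Classical in
/-- The variation of the angle of a circle-valued map `γ` between two points, computed with a
continuous choice of the angle on the whole source (and `0` if there is none). -/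
noncomputable def angleVariation {A : Type*} [TopologicalSpace A] (γ : C(A, Circle)) (a b : A) :
    ℝ :=
  if h : ∃ θ : C(A, ℝ), ∀ x, Circle.exp (θ x) = γ x then h.choose b - h.choose a else 0

theorem angleVariation_eq {A : Type*} [TopologicalSpace A] [PreconnectedSpace A]
    {γ : C(A, Circle)} {θ : A → ℝ} (hθ : Continuous θ) (h : ∀ x, Circle.exp (θ x) = γ x)
    (a b : A) : angleVariation γ a b = θ b - θ a := by
  have H : ∃ θ : C(A, ℝ), ∀ x, Circle.exp (θ x) = γ x := ⟨⟨θ, hθ⟩, h⟩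
  rw [angleVariation, dif_pos H]
  exact circle_lift_sub_eq H.choose.continuous hθ (fun x ↦ by rw [H.choose_spec, h]) a b

/-! ### Maps into and out of suspensions -/

namespace UnreducedSuspension

variable {X : Type u}

/-- The quotient map from the cylinder. -/
def mk (p : X × I) : UnreducedSuspension X := Quot.mk _ (Sum.inl p)

/-- The suspension points: `pole false` is the bottom, `pole true` the top. -/
def pole (X : Type u) (b : Bool) : UnreducedSuspension X := Quot.mk _ (Sum.inr b)

theorem mk_zero (x : X) : mk (x, 0) = pole X false := Quot.sound (.bottom x)

theorem mk_one (x : X) : mk (x, 1) = pole X true := Quot.sound (.top x)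

@[elab_as_elim]
theorem ind [Nonempty X] {p : UnreducedSuspension X → Prop} (h : ∀ x t, p (mk (x, t)))
    (z : UnreducedSuspension X) : p z := by
  obtain ⟨x⟩ := ‹Nonempty X›
  induction z using Quot.ind with | mk z =>
  obtain ⟨y, t⟩ | (_ | _) := z
  · exact h y t
  · change p (pole X false)
    exact mk_zero x ▸ h x 0
  · change p (pole X true)
    exact mk_one x ▸ h x 1

/-- The map out of the suspension induced by a map on the cylinder. -/
def desc {Z : Type*} (F : X × I → Z) (a b : Z) (h0 : ∀ x, F (x, 0) = a) (h1 : ∀ x, F (x, 1) = b) :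
    UnreducedSuspension X → Z :=
  Quot.lift (Sum.elim F (fun i ↦ bif i then b else a)) (by
    rintro _ _ (x | x)
    exacts [h0 x, h1 x])

@[simp]
theorem desc_mk {Z : Type*} (F : X × I → Z) (a b : Z) (h0 : ∀ x, F (x, 0) = a) (h1 : ∀ x, F (x, 1) = b)
    (p : X × I) : desc F a b h0 h1 (mk p) = F p := rfl

variable [TopologicalSpace X] {Z : Type*} [TopologicalSpace Z]

theorem isQuotientMap_quotMk :
    IsQuotientMap (Quot.mk (SuspensionRel X) : (X × I) ⊕ Bool → UnreducedSuspension X) :=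
  isQuotientMap_quot_mk

@[fun_prop]
theorem continuous_mk : Continuous (mk : X × I → UnreducedSuspension X) :=
  isQuotientMap_quotMk.continuous.comp continuous_inl

theorem continuous_desc {F : X × I → Z} (hF : Continuous F) (a b : Z) (h0 : ∀ x, F (x, 0) = a)
    (h1 : ∀ x, F (x, 1) = b) : Continuous (desc F a b h0 h1) :=
  isQuotientMap_quotMk.continuous_iff.2 (hF.sumElim continuous_of_discreteTopology)

theorem continuous_of_comp_mk [Nonempty X] {f : UnreducedSuspension X → Z}
    (hf : Continuous (f ∘ mk)) : Continuous f := by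
  convert continuous_desc hf (f (pole X false)) (f (pole X true))
    (fun x ↦ by simp [mk_zero]) (fun x ↦ by simp [mk_one]) using 1
  ext z
  induction z using ind
  rfl

instance [Nonempty X] [CompactSpace X] : CompactSpace (UnreducedSuspension X) :=
  Function.Surjective.compactSpace (f := (mk : X × I → UnreducedSuspension X)) continuous_mk
    (fun z ↦ by induction z using ind with | h x t => exact ⟨_, rfl⟩)

/-- The height function of the suspension. -/
def height : C(UnreducedSuspension X, ℝ) :=
  ⟨desc (fun p ↦ (p.2 : ℝ)) 0 1 (by simp) (by simp), continuous_desc (by fun_prop) _ _ _ _⟩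

@[simp]
theorem height_mk (x : X) (t : I) : height (mk (x, t)) = t := rfl

/-- A deformation of the interval relative to its ends deforms the suspension. -/
theorem homotopic_of_interval_homotopy [Nonempty X] (φ : C(I × I, I)) (h0 : ∀ s, φ (s, 0) = 0)
    (h1 : ∀ s, φ (s, 1) = 1) (hid : ∀ t, φ (0, t) = t) :
    ∃ H : C(I × UnreducedSuspension X, UnreducedSuspension X),
      (∀ z, H (0, z) = z) ∧ ∀ s x t, H (s, mk (x, t)) = mk (x, φ (s, t)) := by
  have key : Continuous fun p : I × UnreducedSuspension X ↦
      desc (fun q : X × I ↦ mk (q.1, φ (p.1, q.2))) (pole X false) (pole X true)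
        (fun x ↦ by simp [h0, mk_zero]) (fun x ↦ by simp [h1, mk_one]) p.2 := by
    -- `I` is locally compact, so its product with the quotient map is again a quotient map.
    refine isQuotientMap_quotMk.continuous_lift_prod_right ?_
    rw [← (Homeomorph.prodSumDistrib : I × ((X × I) ⊕ Bool) ≃ₜ
      (I × (X × I)) ⊕ (I × Bool)).symm.comp_continuous_iff']
    refine continuous_sum_dom.2 ⟨?_, ?_⟩
    · change Continuous fun p : I × (X × I) ↦ mk (p.2.1, φ (p.1, p.2.2))
      fun_prop
    · change Continuous fun p : I × Bool ↦ (bif p.2 then pole X true else pole X false)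
      exact (continuous_of_discreteTopology
        (f := fun b ↦ bif b then pole X true else pole X false)).comp continuous_snd
  refine ⟨⟨_, key⟩, fun z ↦ ?_, fun s x t ↦ rfl⟩
  induction z using ind with | h x t =>
  simp [hid]

theorem isAmbientlyContractible_of_interval_homotopy [Nonempty X] (φ : C(I × I, I))
    (h0 : ∀ s, φ (s, 0) = 0) (h1 : ∀ s, φ (s, 1) = 1) (hid : ∀ t, φ (0, t) = t) (b : Bool)
    {A : Set (UnreducedSuspension X)}
    (hA : ∀ x t, mk (x, t) ∈ A → mk (x, φ (1, t)) = pole X b) : IsAmbientlyContractible A := by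
  obtain ⟨H, H0, H1⟩ := homotopic_of_interval_homotopy (X := X) φ h0 h1 hid
  refine ⟨pole X b, ⟨⟨H.comp (.prodMap (.id I) ⟨_, continuous_subtype_val⟩), ?_, ?_⟩⟩⟩
  · rintro ⟨z, hz⟩
    simp [H0]
  · rintro ⟨z, hz⟩
    induction z using ind with | h x t =>
    simp [H1, hA x t hz]

theorem isDoldSpace [Nonempty X] : IsDoldSpace (UnreducedSuspension X) := by
  let ρ : C(UnreducedSuspension X, ℝ) :=
    ⟨fun z ↦ projIcc (0 : ℝ) 1 zero_le_one (3 * height z - 1), by fun_prop⟩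
  have hρ (z) : 0 ≤ ρ z ∧ ρ z ≤ 1 := (projIcc (0 : ℝ) 1 zero_le_one (3 * height z - 1)).2
  have hlow (z) (h : ρ z ≠ 0) : 1 / 3 ≤ height z := by
    contrapose! h
    exact congrArg Subtype.val (projIcc_of_le_left (h := zero_le_one) (by linarith))
  have hhigh (z) (h : 1 - ρ z ≠ 0) : height z ≤ 2 / 3 := by
    contrapose! h
    have : ρ z = 1 :=
      congrArg Subtype.val (projIcc_of_right_le (h := zero_le_one) (by linarith))
    rw [this, sub_self]
  let f : ULift.{u} Bool → C(UnreducedSuspension X, ℝ) := fun i ↦ bif i.down then ρ else 1 - ρ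
  have hsum (z) : ∑ᶠ i, f i z = 1 := by
    rw [finsum_eq_sum_of_fintype, ← Equiv.ulift.symm.sum_comp]
    simp [f, Equiv.ulift]
  let U : ULift.{u} Bool → Set (UnreducedSuspension X) := fun i ↦
    bif i.down then {z | 1 / 3 ≤ height z} else {z | height z ≤ 2 / 3}
  refine ⟨ULift Bool, U, ⟨⟨f, locallyFinite_of_finite _, ?_, fun z _ ↦ hsum z,
    fun z ↦ (hsum z).le⟩, ?_⟩, ?_⟩
  · rintro ⟨_ | _⟩ z
    · exact sub_nonneg.2 (hρ z).2
    · exact (hρ z).1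
  · rintro ⟨_ | _⟩
    · exact closure_minimal (fun z hz ↦ hhigh z hz) (isClosed_le (by fun_prop) (by fun_prop))
    · exact closure_minimal (fun z hz ↦ hlow z hz) (isClosed_le (by fun_prop) (by fun_prop))
  -- Straight-line homotopy from `t` to `3t - c` clamped to `I`: `c = 2` sends heights at most 2/3
  -- to 0, and `c = 0` sends heights at least 1/3 to 1. The outer projection only serves to land in
  -- `I`.
  · have hφ (c : ℝ) : Continuous fun p : I × I ↦
        projIcc (0 : ℝ) 1 zero_le_one
          ((1 - p.1) * p.2 + p.1 * projIcc (0 : ℝ) 1 zero_le_one (3 * p.2 - c)) := by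
      fun_prop
    have hc0 (c : ℝ) (hc : 0 ≤ c) : projIcc (0 : ℝ) 1 zero_le_one (3 * 0 - c) = 0 :=
      projIcc_of_le_left _ (by linarith)
    have hc1 (c : ℝ) (hc : c ≤ 2) : projIcc (0 : ℝ) 1 zero_le_one (3 * 1 - c) = 1 :=
      projIcc_of_right_le _ (by linarith)
    rintro ⟨_ | _⟩
    · refine isAmbientlyContractible_of_interval_homotopy ⟨_, hφ 2⟩ (fun s ↦ ?_) (fun s ↦ ?_)
        (fun t ↦ ?_) false fun x t ht ↦ ?_
      · simp only [ContinuousMap.coe_mk, Set.Icc.coe_zero, hc0 2 (by norm_num)]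
        simp
      · simp only [ContinuousMap.coe_mk, Set.Icc.coe_one, hc1 2 (by norm_num)]
        simp
      · simp
      · have ht : (t : ℝ) ≤ 2 / 3 := ht
        rw [← mk_zero x]
        have : projIcc (0 : ℝ) 1 zero_le_one (3 * t - 2) = 0 :=
          projIcc_of_le_left _ (by linarith)
        simp [this]
    · refine isAmbientlyContractible_of_interval_homotopy ⟨_, hφ 0⟩ (fun s ↦ ?_) (fun s ↦ ?_)
        (fun t ↦ ?_) true fun x t ht ↦ ?_
      · simp only [ContinuousMap.coe_mk, Set.Icc.coe_zero, hc0 0 (by norm_num)]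
        simp
      · simp only [ContinuousMap.coe_mk, Set.Icc.coe_one, hc1 0 (by norm_num)]
        simp
      · simp
      · have ht : 1 / 3 ≤ (t : ℝ) := ht
        rw [← mk_one x]
        have : projIcc (0 : ℝ) 1 zero_le_one (3 * t - 0) = 1 :=
          projIcc_of_right_le _ (by linarith)
        simp only [sub_zero] at this
        simp [this]

end UnreducedSuspension

/-! ### Circle-valued functions on suspensions of sets of reals -/

namespace UnreducedSuspension

variable {Y : Set ℝ}

/-- The base coordinate of a point of the suspension of a set of reals. Its value at the
suspension points is irrelevant. -/
noncomputable def baseCoord (z : UnreducedSuspension Y) : ℝ :=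
  desc (fun p : Y × I ↦ (p.1 : ℝ) * (p.2 * (1 - p.2))) 0 0 (by simp) (by simp) z /
    (height z * (1 - height z))

theorem baseCoord_mk (y : Y) {t : I} (ht : (t : ℝ) ∈ Ioo 0 1) : baseCoord (mk (y, t)) = y := by
  have := ht.1.ne'
  have := (sub_pos.2 ht.2).ne'
  simp only [baseCoord, desc_mk, height_mk]
  field_simp

/-- The factor `t (1 - t)` makes the numerator vanish at both poles, so it descends continuously to
the suspension; between the poles it can be divided out. -/
theorem continuousOn_baseCoord :
    ContinuousOn (baseCoord (Y := Y)) {z | height z ∈ Ioo 0 1} := by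
  refine ((continuous_desc ?_ _ _ _ _).continuousOn).div (by fun_prop) fun z hz ↦
    (mul_pos hz.1 (sub_pos.2 hz.2)).ne'
  fun_prop

theorem baseCoord_mem [Nonempty Y] {z : UnreducedSuspension Y} (hz : height z ∈ Ioo 0 1) :
    baseCoord z ∈ Y := by
  induction z using ind with | h y t =>
  rw [height_mk] at hz
  exact baseCoord_mk y hz ▸ y.2

open Classical in
/-- The function on the suspension of `Y` winding once around the circle on the meridians over
`S`, and constant on the others. It need not be continuous. -/
noncomputable def meridianWinding (S : Set ℝ) (z : UnreducedSuspension Y) : Circle :=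
  if baseCoord z ∈ S then Circle.exp (2 * Real.pi * height z) else 1

/-- At the poles `baseCoord` carries no information, but both branches then equal 1. -/
theorem meridianWinding_mk (S : Set ℝ) (y : Y) (t : I) [Decidable ((y : ℝ) ∈ S)] :
    meridianWinding S (mk (y, t)) =
      Circle.exp (2 * Real.pi * ((if (y : ℝ) ∈ S then 1 else 0) * t)) := by
  rcases t.2.1.eq_or_lt with h | h
  · simp [meridianWinding, ← h]
  rcases t.2.2.eq_or_lt with h' | h'
  · simp [meridianWinding, h']
    split_ifs <;> simp
  · rw [meridianWinding, baseCoord_mk y ⟨h, h'⟩, height_mk]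
    split_ifs <;> simp

theorem continuous_meridianWinding [Nonempty Y] {S : Set ℝ} (hS : IsClopen ((↑) ⁻¹' S : Set Y)) :
    Continuous (meridianWinding (Y := Y) S) := by
  classical
  refine continuous_of_comp_mk ?_
  have : Continuous fun y : Y ↦ (if (y : ℝ) ∈ S then 1 else 0 : ℝ) :=
    Continuous.if (fun y hy ↦ by
      rw [show {y : Y | (y : ℝ) ∈ S} = (↑) ⁻¹' S from rfl, hS.frontier_eq] at hy
      exact hy.elim) continuous_const continuous_const
  have h : (meridianWinding S ∘ mk : Y × I → Circle) = fun p ↦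
      Circle.exp (2 * Real.pi * ((if (p.1 : ℝ) ∈ S then 1 else 0) * p.2)) :=
    funext fun p ↦ meridianWinding_mk S p.1 p.2
  rw [h]
  exact Circle.exp.continuous.comp (continuous_const.mul
    ((this.comp continuous_fst).mul (by fun_prop)))

/-- A locally connected space does not see the topology of a totally disconnected base. -/
theorem continuous_meridianWinding_comp [Nonempty Y] (hY : IsTotallyDisconnected Y) (S : Set ℝ)
    {A : Type*} [TopologicalSpace A] [LocallyConnectedSpace A] {g : A → UnreducedSuspension Y}
    (hg : Continuous g) : Continuous (meridianWinding S ∘ g) := by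
  classical
  have hexp : Continuous fun a ↦ Circle.exp (2 * Real.pi * height (g a)) := by fun_prop
  rw [continuous_iff_continuousAt]
  intro a
  -- Where the exponential is 1, in particular over the poles, both branches are near 1, whichever
  -- is taken.
  by_cases h1 : Circle.exp (2 * Real.pi * height (g a)) = 1
  · have ha : (meridianWinding S ∘ g) a = 1 := by simp [meridianWinding, h1]
    rw [ContinuousAt, ha, tendsto_nhds]
    intro U hU h1U
    filter_upwards [hexp.continuousAt (hU.mem_nhds (h1 ▸ h1U))] with b hb
    simp only [mem_preimage, Function.comp, meridianWinding]
    split_ifs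
    exacts [hb, h1U]
  have hV : IsOpen (g ⁻¹' {z | height z ∈ Ioo (0 : ℝ) 1}) :=
    (isOpen_Ioo.preimage height.continuous).preimage hg
  have ha : a ∈ g ⁻¹' {z | height z ∈ Ioo (0 : ℝ) 1} := by
    have : ∀ z : UnreducedSuspension Y, Circle.exp (2 * Real.pi * height z) ≠ 1 →
        height z ∈ Ioo (0 : ℝ) 1 := by
      intro z hz
      induction z using ind with | h y t =>
      rw [height_mk] at hz ⊢
      refine ⟨t.2.1.lt_of_ne fun h ↦ hz ?_, t.2.2.lt_of_ne fun h ↦ hz ?_⟩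
      · simp [← h]
      · simp [h]
    exact this _ h1
  have hC := connectedComponentIn_mem_nhds (hV.mem_nhds ha)
  have hsub := connectedComponentIn_subset (g ⁻¹' {z | height z ∈ Ioo (0 : ℝ) 1}) a
  -- `baseCoord ∘ g` maps this connected neighbourhood into a totally disconnected set, so it is
  -- constant and only one branch occurs.
  have hcoord : ∀ b ∈ connectedComponentIn (g ⁻¹' {z | height z ∈ Ioo (0 : ℝ) 1}) a,
      baseCoord (g b) = baseCoord (g a) := fun b hb ↦
    hY _ (by rintro _ ⟨c, hc, rfl⟩; exact baseCoord_mem (hsub hc))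
      (isPreconnected_connectedComponentIn.image _
        ((continuousOn_baseCoord.comp hg.continuousOn (mapsTo_preimage _ _)).mono hsub))
      ⟨b, hb, rfl⟩ ⟨a, mem_connectedComponentIn ha, rfl⟩
  have heq : (meridianWinding S ∘ g) =ᶠ[𝓝 a] fun b ↦
      if baseCoord (g a) ∈ S then Circle.exp (2 * Real.pi * height (g b)) else 1 := by
    filter_upwards [hC] with b hb
    simp [meridianWinding, hcoord b hb]
  refine ContinuousAt.congr ?_ heq.symm
  split_ifs
  exacts [hexp.continuousAt, continuousAt_const]

end UnreducedSuspension

/-- A map from a CW complex is continuous as soon as it is so on each closed cell. -/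
theorem Topology.CWComplex.continuous_of_comp_map {Z : Type*} [TopologicalSpace Z] [T2Space Z]
    [CWComplex (univ : Set Z)] {B : Type*} [TopologicalSpace B] {f : Z → B}
    (hf : ∀ (n : ℕ) (j : RelCWComplex.cell (univ : Set Z) n),
      ContinuousOn (f ∘ RelCWComplex.map (C := (univ : Set Z)) n j) (Metric.closedBall 0 1)) :
    Continuous f := by
  refine continuous_iff_isClosed.2 fun K hK ↦ CWComplex.closed' (C := univ) _ (subset_univ _)
    fun n j ↦ ?_
  have : f ⁻¹' K ∩ RelCWComplex.map (C := (univ : Set Z)) n j '' Metric.closedBall 0 1 =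
      RelCWComplex.map (C := (univ : Set Z)) n j ''
        (Metric.closedBall 0 1 ∩ (f ∘ RelCWComplex.map (C := (univ : Set Z)) n j) ⁻¹' K) := by
    ext z
    constructor
    · rintro ⟨hz, x, hx, rfl⟩
      exact ⟨x, ⟨hx, hz⟩, rfl⟩
    · rintro ⟨x, ⟨hx, hz⟩, rfl⟩
      exact ⟨hz, x, hx, rfl⟩
  change IsClosed (f ⁻¹' K ∩ RelCWComplex.map (C := (univ : Set Z)) n j '' Metric.closedBall 0 1)
  rw [this]
  refine IsCompact.isClosed (IsCompact.image_of_continuousOn ?_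
    ((RelCWComplex.continuousOn (C := (univ : Set Z)) n j).mono inter_subset_left))
  exact (isCompact_closedBall 0 1).of_isClosed_subset
    ((hf n j).preimage_isClosed_of_isClosed Metric.isClosed_closedBall hK) inter_subset_left

/-! ### Obstruction to CW homotopy type -/

namespace UnreducedSuspension

variable {Y : Set ℝ}

theorem continuous_meridianWinding_comp_of_cwComplex [Nonempty Y] (hY : IsTotallyDisconnected Y)
    (S : Set ℝ) {Z : Type*} [TopologicalSpace Z] [T2Space Z] [CWComplex (univ : Set Z)]
    {g : Z → UnreducedSuspension Y} (hg : Continuous g) : Continuous (meridianWinding S ∘ g) := by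
  refine CWComplex.continuous_of_comp_map fun n j ↦ ?_
  have := (convex_closedBall (0 : Fin n → ℝ) 1).locallyPathConnectedSpace
  exact continuousOn_iff_continuous_domRestrict.2 <| continuous_meridianWinding_comp hY S
    (hg.comp (continuousOn_iff_continuous_domRestrict.1 (RelCWComplex.continuousOn n j)))

/-- The angle variation of a circle-valued function along a meridian varies by less than a half
turn between close meridians. -/
theorem exists_nhds_meridian_sub_lt {Y : Type*} [TopologicalSpace Y]
    {k : UnreducedSuspension Y → Circle} (hk : Continuous k)
    {θ : Y → I → ℝ} (hθ : ∀ y, Continuous (θ y)) (h : ∀ y t, Circle.exp (θ y t) = k (mk (y, t)))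
    (y₀ : Y) : ∀ᶠ y in 𝓝 y₀, θ y 1 - θ y 0 < θ y₀ 1 - θ y₀ 0 + Real.pi := by
  have hopen : IsOpen {p : Y × I | k (mk p) / k (mk (y₀, p.2)) ≠ Circle.exp Real.pi} :=
    isOpen_ne_fun (by fun_prop) (by fun_prop)
  -- Tube lemma: for `y` near `y₀` the ratio of the two values avoids -1 at every height.
  have := isCompact_univ.eventually_forall_of_forall_eventually (x₀ := y₀) (K := (univ : Set I))
    (P := fun y t ↦ k (mk (y, t)) / k (mk (y₀, t)) ≠ Circle.exp Real.pi)
    (fun t _ ↦ hopen.mem_nhds (x := (y₀, t)) (by simpa using Circle.exp_pi_ne_one.symm))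
  filter_upwards [this] with y hy
  by_contra! hlt
  have hc : Continuous fun t ↦ θ y t - θ y₀ t := (hθ y).sub (hθ y₀)
  -- The meridians start at the same pole, with ratio 1; a relative gain of at least π would pass
  -- through exactly π, where the ratio is -1.
  obtain ⟨t, ht⟩ := mem_range_of_exists_le_of_exists_ge hc
    (c := θ y 0 - θ y₀ 0 + Real.pi) ⟨0, by linarith [Real.pi_pos]⟩ ⟨1, by linarith⟩
  refine hy t (mem_univ _) ?_
  simp only at ht
  rw [← h, ← h, ← Circle.exp_sub, ht, Circle.exp_add, Circle.exp_sub, h, h, mk_zero, mk_zero]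
  simp

theorem not_hasCWHomotopyType (hY : IsTotallyDisconnected Y) {y₀ : Y} (hacc : (𝓝[≠] y₀).NeBot) :
    ¬ HasCWHomotopyType.{0, v} (UnreducedSuspension Y) := by
  classical
  rintro ⟨Z, _, _, ⟨_⟩, ⟨e⟩⟩
  have : Nonempty Y := ⟨y₀⟩
  obtain ⟨H⟩ := e.left_inv
  let S : Set ℝ := {(y₀ : ℝ)}ᶜ
  have hk : Continuous (meridianWinding S ∘ e.invFun ∘ e.toFun) :=
    (continuous_meridianWinding_comp_of_cwComplex hY S e.invFun.continuous).comp
      e.toFun.continuous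
  have : LocallyPathConnectedSpace I := (convex_Icc 0 1).locallyPathConnectedSpace
  have : ContractibleSpace I := (convex_Icc 0 1).contractibleSpace ⟨0, by simp⟩
  -- The winding itself jumps at `y₀`, but each square is locally connected.
  have hw (y : Y) : Continuous (meridianWinding S ∘ fun p : I × I ↦ H (p.1, mk (y, p.2))) :=
    continuous_meridianWinding_comp hY S (by fun_prop)
  choose θ hθ using fun y ↦ exists_circle_lift ⟨_, hw y⟩
  simp only [ContinuousMap.coe_mk, Function.comp] at hθ
  have hside (y : Y) (b : I) (hb : ∀ y : Y, mk (y, b) = mk (y₀, b)) :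
      θ y (1, b) - θ y (0, b) = θ y₀ (1, b) - θ y₀ (0, b) :=
    circle_lift_sub_eq (θ := fun s ↦ θ y (s, b)) (θ' := fun s ↦ θ y₀ (s, b)) (by fun_prop)
      (by fun_prop) (fun s ↦ by rw [hθ, hθ, hb]) 0 1
  have hend (y : Y) : θ y (1, 1) - θ y (1, 0) = 2 * Real.pi * (if (y : ℝ) ∈ S then 1 else 0) := by
    have := circle_lift_sub_eq (θ := fun t ↦ θ y (1, t))
      (θ' := fun t : I ↦ 2 * Real.pi * ((if (y : ℝ) ∈ S then 1 else 0) * t)) (by fun_prop)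
      (by fun_prop) (fun t ↦ by rw [hθ, ← meridianWinding_mk]; simp) 0 1
    simpa using this
  have hlt := exists_nhds_meridian_sub_lt hk (θ := fun y t ↦ θ y (0, t)) (fun y ↦ by fun_prop)
    (fun y t ↦ by rw [hθ]; simp [Function.comp]) y₀
  obtain ⟨y, hy, hne⟩ := ((hlt.filter_mono nhdsWithin_le_nhds).and
    (self_mem_nhdsWithin (a := y₀) (s := {y₀}ᶜ))).exists
  have h0 := hside y 0 (fun y ↦ by rw [mk_zero, mk_zero])
  have h1 := hside y 1 (fun y ↦ by rw [mk_one, mk_one])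
  have h2 := hend y
  have h3 := hend y₀
  have hyS : (y : ℝ) ∈ S := fun h ↦ hne (Subtype.ext h)
  have hyS' : (y₀ : ℝ) ∉ S := fun h ↦ h rfl
  rw [if_pos hyS] at h2
  rw [if_neg hyS'] at h3
  -- Going around both squares, the pole sides cancel, so the variations of `k` at `y` and `y₀`
  -- differ by 2π, against the bound π.
  linarith [Real.pi_pos]

end UnreducedSuspension

open CategoryTheory Limits Simplicial

/-! ### First homology classes and one-dimensional cocycles -/

/-- The integers, as the coefficients of singular homology. -/
abbrev intCoeff : ModuleCat.{0} ℤ := ModuleCat.of ℤ (ULift.{0} ℤ)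

/-- The homomorphism `ℤ → ℝ` sending `1` to `r`. -/
noncomputable def intCoeffToReal (r : ℝ) : intCoeff ⟶ ModuleCat.of ℤ ℝ :=
  ModuleCat.ofHom ((LinearMap.toSpanSingleton ℤ ℝ r).comp ULift.moduleEquiv.toLinearMap)

theorem intCoeffToReal_one (r : ℝ) : (intCoeffToReal r).hom ⟨1⟩ = r := by
  simp [intCoeffToReal]

theorem intCoeffToReal_zero : intCoeffToReal 0 = 0 := by
  simp [intCoeffToReal]

theorem intCoeffToReal_add (r s : ℝ) :
    intCoeffToReal (r + s) = intCoeffToReal r + intCoeffToReal s := by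
  ext
  simp [intCoeffToReal]

theorem intCoeffToReal_sub (r s : ℝ) :
    intCoeffToReal (r - s) = intCoeffToReal r - intCoeffToReal s := by
  ext
  simp [intCoeffToReal, mul_sub]

namespace SSet

variable (S : SSet.{0})

/-- The homomorphism on `1`-chains given by a real function on `1`-simplices. -/
noncomputable def cochainHom (c : S _⦋1⦌ → ℝ) :
    (S.chainComplex intCoeff).X 1 ⟶ ModuleCat.of ℤ ℝ :=
  Cofan.IsColimit.desc (S.isColimitChainComplexXCofan intCoeff 1) fun x ↦ intCoeffToReal (c x)

@[simp]
theorem ι_cochainHom (c : S _⦋1⦌ → ℝ) (x : S _⦋1⦌) :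
    S.ιChainComplex x ≫ S.cochainHom c = intCoeffToReal (c x) :=
  Cofan.IsColimit.fac (S.isColimitChainComplexXCofan intCoeff 1) _ x

/-- The homomorphism on the first homology given by a real `1`-cocycle. -/
noncomputable def cocycleHom (c : S _⦋1⦌ → ℝ)
    (hc : ∀ x : S _⦋2⦌, c (S.δ 0 x) - c (S.δ 1 x) + c (S.δ 2 x) = 0) :
    S.homology intCoeff 1 ⟶ ModuleCat.of ℤ ℝ :=
  -- Homology embeds in chains modulo boundaries, and a cocycle kills boundaries.
  (S.chainComplex intCoeff).homologyι 1 ≫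
    (S.chainComplex intCoeff).descOpcycles (S.cochainHom c) 2 (by simp) (by
      refine chainComplex_hom_ext fun x ↦ ?_
      rw [ιChainComplex_d_assoc, comp_zero, Fin.sum_univ_three]
      simpa [Preadditive.add_comp, ← sub_eq_add_neg, intCoeffToReal_add, intCoeffToReal_sub,
        intCoeffToReal_zero] using congrArg intCoeffToReal (hc x))

/-- The homology class of the difference of two parallel `1`-simplices. -/
noncomputable def differenceClass (s t : S _⦋1⦌) (h0 : S.δ 0 s = S.δ 0 t)
    (h1 : S.δ 1 s = S.δ 1 t) : intCoeff ⟶ S.homology intCoeff 1 :=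
  (S.chainComplex intCoeff).liftCycles (S.ιChainComplex s - S.ιChainComplex t) 0 (by simp) (by
    rw [Preadditive.sub_comp, ιChainComplex_d, ιChainComplex_d]
    simp [Fin.sum_univ_two, h0, h1]) ≫ (S.chainComplex intCoeff).homologyπ 1

theorem differenceClass_cocycleHom (s t : S _⦋1⦌) (h0 : S.δ 0 s = S.δ 0 t)
    (h1 : S.δ 1 s = S.δ 1 t) (c : S _⦋1⦌ → ℝ)
    (hc : ∀ x : S _⦋2⦌, c (S.δ 0 x) - c (S.δ 1 x) + c (S.δ 2 x) = 0) :
    S.differenceClass s t h0 h1 ≫ S.cocycleHom c hc = intCoeffToReal (c s - c t) := by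
  rw [differenceClass, cocycleHom, Category.assoc, HomologicalComplex.homology_π_ι_assoc,
    HomologicalComplex.liftCycles_i_assoc, HomologicalComplex.p_descOpcycles,
    Preadditive.sub_comp, ι_cochainHom, ι_cochainHom, intCoeffToReal_sub]

end SSet

namespace TopCat

variable {X : TopCat.{0}}

/-- The angle variation of a circle-valued function on `X` along a singular `1`-simplex. -/
noncomputable def angleCochain (f : C(X, Circle)) (s : toSSet.obj X _⦋1⦌) : ℝ :=
  angleVariation (f.comp (X.toSSetObjEquiv _ s)) (stdSimplex.vertex (S := ℝ) (X := Fin 2) 0)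
    (stdSimplex.vertex (S := ℝ) (X := Fin 2) 1)

/-- One lift on the contractible 2-simplex restricts to lifts on all three faces, so the alternating
sum of vertex differences telescopes. -/
theorem angleCochain_cocycle (f : C(X, Circle)) (x : toSSet.obj X _⦋2⦌) :
    angleCochain f ((toSSet.obj X).δ 0 x) - angleCochain f ((toSSet.obj X).δ 1 x) +
      angleCochain f ((toSSet.obj X).δ 2 x) = 0 := by
  have hconv := convex_stdSimplex ℝ (Fin 3)
  have := hconv.locallyPathConnectedSpace
  have := hconv.contractibleSpace ⟨_, (stdSimplex.vertex (S := ℝ) (0 : Fin 3)).2⟩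
  obtain ⟨θ, hθ⟩ : ∃ θ : C(stdSimplex ℝ (Fin 3), ℝ), ∀ z, Circle.exp (θ z) = _ :=
    exists_circle_lift (f.comp (X.toSSetObjEquiv _ x))
  have key (i : Fin 3) : angleCochain f ((toSSet.obj X).δ i x) =
      θ (stdSimplex.vertex (i.succAbove 1)) - θ (stdSimplex.vertex (i.succAbove 0)) := by
    have h := angleVariation_eq (A := stdSimplex ℝ (Fin 2))
      (γ := f.comp (X.toSSetObjEquiv _ ((toSSet.obj X).δ i x)))
      (θ := fun z ↦ θ (stdSimplex.map i.succAbove z))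
      (θ.continuous.comp (stdSimplex.continuous_map _))
      (fun z ↦ by
        rw [hθ]
        exact congrArg f (toSSetObjEquiv_δ_apply x i z).symm)
      (stdSimplex.vertex 0) (stdSimplex.vertex 1)
    simp only [stdSimplex.map_vertex] at h
    exact h
  rw [key, key, key]
  simp [Fin.succAbove]

end TopCat

/-! ### Meridian classes in first homology -/

namespace UnreducedSuspension

variable {Y : Type} [TopologicalSpace Y]

/-- The meridian over a point, as a singular simplex. -/
noncomputable def meridian (y : Y) : TopCat.toSSet.obj (TopCat.of (UnreducedSuspension Y)) _⦋1⦌ :=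
  (TopCat.toSSetObjEquiv _ _).symm
    ⟨fun z : stdSimplex ℝ (Fin 2) ↦ mk (y, stdSimplexHomeomorphUnitInterval z), by fun_prop⟩

theorem δ_meridian (y y' : Y) (i : Fin 2) :
    (TopCat.toSSet.obj _).δ i (meridian y) = (TopCat.toSSet.obj _).δ i (meridian y') := by
  apply (TopCat.toSSetObjEquiv _ _).injective
  ext z
  refine (TopCat.toSSetObjEquiv_δ_apply _ _ _).trans
    (.trans ?_ (TopCat.toSSetObjEquiv_δ_apply _ _ _).symm)
  simp only [meridian, Equiv.apply_symm_apply]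
  obtain rfl : z = stdSimplex.vertex (S := ℝ) (X := Fin 1) 0 := Subsingleton.elim _ _
  rw [stdSimplex.map_vertex]
  fin_cases i
  · exact (mk_one y).trans (mk_one y').symm
  · exact (mk_zero y).trans (mk_zero y').symm

/-- The class of the loop going up along the meridian over `y` and down along that over `y'`. -/
noncomputable def meridianClass (y y' : Y) : integralH1 (UnreducedSuspension Y) :=
  (SSet.differenceClass _ (meridian y) (meridian y') (δ_meridian _ _ _)
    (δ_meridian _ _ _)).hom ⟨1⟩

/-- The homomorphism on the first homology given by a circle-valued function. -/
noncomputable def angleHom {X : Type} [TopologicalSpace X] (f : C(X, Circle)) :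
    integralH1 X →ₗ[ℤ] ℝ :=
  (SSet.cocycleHom (TopCat.toSSet.obj (TopCat.of X)) (TopCat.angleCochain f)
    (TopCat.angleCochain_cocycle (X := .of X) f)).hom

theorem angleHom_meridianClass (f : C(UnreducedSuspension Y, Circle)) (y y' : Y) (θ θ' : C(I, ℝ))
    (hθ : ∀ t, Circle.exp (θ t) = f (mk (y, t))) (hθ' : ∀ t, Circle.exp (θ' t) = f (mk (y', t))) :
    angleHom f (meridianClass y y') = (θ 1 - θ 0) - (θ' 1 - θ' 0) := by
  have key (y : Y) (θ : C(I, ℝ)) (hθ : ∀ t, Circle.exp (θ t) = f (mk (y, t))) :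
      TopCat.angleCochain (X := TopCat.of (UnreducedSuspension Y)) f (meridian y) = θ 1 - θ 0 :=
    angleVariation_eq (A := stdSimplex ℝ (Fin 2))
      (θ := fun z ↦ θ (stdSimplexHomeomorphUnitInterval z)) (by fun_prop) (fun z ↦ hθ _) _ _
  have h := congr(($(SSet.differenceClass_cocycleHom _ (meridian y) (meridian y')
    (δ_meridian _ _ _) (δ_meridian _ _ _) _
    (TopCat.angleCochain_cocycle (X := .of (UnreducedSuspension Y)) f))).hom ⟨1⟩)
  rwa [intCoeffToReal_one, key y θ hθ, key y' θ' hθ'] at h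

/-- The winding over `s m` pairs with the class of `s n` against `y₀` to 2π if `m = n` and 0
otherwise. The classes are thus independent, impossible for an infinite family in a Noetherian
module. -/
theorem not_finite_integralH1 {Y : Set ℝ} (y₀ : Y) {s : ℕ → Y} (hinj : Function.Injective s)
    (hne : ∀ n, s n ≠ y₀) (hs : ∀ n, IsClopen {s n}) :
    ¬ Module.Finite ℤ (integralH1 (UnreducedSuspension Y)) := by
  classical
  intro hfin
  have : Nonempty Y := ⟨y₀⟩
  let f (n : ℕ) : C(UnreducedSuspension Y, Circle) := ⟨meridianWinding {(s n : ℝ)},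
    continuous_meridianWinding (by convert hs n; ext; simp [Subtype.ext_iff])⟩
  have hpair (m n : ℕ) :
      angleHom (f m) (meridianClass (s n) y₀) = if n = m then 2 * Real.pi else 0 := by
    let θ (y : Y) : C(I, ℝ) :=
      ⟨fun t ↦ 2 * Real.pi * ((if (y : ℝ) ∈ ({(s m : ℝ)} : Set ℝ) then 1 else 0) * t), by fun_prop⟩
    rw [angleHom_meridianClass (f m) _ _ (θ (s n)) (θ y₀)
      (fun t ↦ (meridianWinding_mk _ _ _).symm) (fun t ↦ (meridianWinding_mk _ _ _).symm)]
    have h0 : (y₀ : ℝ) ≠ s m := fun h ↦ hne m (Subtype.ext h.symm)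
    have h1 : (s n : ℝ) = s m ↔ n = m := Subtype.ext_iff.symm.trans hinj.eq_iff
    simp [θ, h0, h1]
  have hli : LinearIndependent ℤ fun n ↦ meridianClass (s n) y₀ := by
    refine linearIndependent_iff'.2 fun F g hg n hn ↦ ?_
    have := congrArg (angleHom (f n)) hg
    simpa [map_sum, hpair, hn, Real.pi_ne_zero] using this
  have := hli.finite_of_isNoetherian
  exact _root_.not_finite ℕ

end UnreducedSuspension

/-! ### The harmonic sequence -/

/-- The points `1 / (n + 1)`. -/
noncomputable def harmonicPoint (n : ℕ) : harmonicSet :=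
  ⟨1 / ((n + 1 : ℕ) : ℝ), Or.inr ⟨n + 1, by simp, rfl⟩⟩

theorem harmonicPoint_injective : Function.Injective harmonicPoint := by
  intro m n h
  simpa [harmonicPoint] using h

theorem harmonicSet_eq : harmonicSet = insert 0 (range fun n : ℕ ↦ 1 / ((n : ℝ) + 1)) := by
  ext y
  constructor
  · rintro (h | ⟨n, hn, rfl⟩)
    · exact Or.inl h
    · exact Or.inr ⟨n - 1, by simp [Nat.cast_sub hn]⟩
  · rintro (h | ⟨n, rfl⟩)
    · exact Or.inl h
    · exact Or.inr ⟨n + 1, by simp, by simp⟩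

instance : CompactSpace harmonicSet := by
  rw [← isCompact_iff_compactSpace, harmonicSet_eq]
  exact tendsto_one_div_add_atTop_nhds_zero_nat.isCompact_insert_range

/-- The limit point of the harmonic set. -/
def harmonicZero : harmonicSet := ⟨0, Or.inl rfl⟩

instance : Nonempty harmonicSet := ⟨harmonicZero⟩

theorem harmonicPoint_ne_zero (n : ℕ) : harmonicPoint n ≠ harmonicZero := by
  intro h
  have : (n : ℝ) + 1 = 0 := by simpa [harmonicPoint, harmonicZero] using congrArg Subtype.val h
  linarith [n.cast_nonneg (α := ℝ)]

theorem tendsto_harmonicPoint : Tendsto harmonicPoint atTop (𝓝 harmonicZero) := by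
  rw [tendsto_subtype_rng]
  simpa [harmonicPoint, harmonicZero] using tendsto_one_div_add_atTop_nhds_zero_nat (𝕜 := ℝ)

/-- The points above `1 / (n + 2)` form a finite open neighbourhood, which isolates the point since
singletons are closed. -/
theorem isClopen_singleton_harmonicPoint (n : ℕ) : IsClopen {harmonicPoint n} := by
  have hn (k : ℕ) : (0 : ℝ) < k + 1 := by positivity
  refine ⟨isClosed_singleton, isOpen_singleton_of_finite_mem_nhds _
    (s := {y | 1 / ((n : ℝ) + 2) < y})
    ((isOpen_lt continuous_const continuous_subtype_val).mem_nhds ?_)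
    (((finite_Iio (n + 1)).image harmonicPoint).subset ?_)⟩
  · simp only [harmonicPoint, mem_ofPred_eq]
    push_cast
    exact one_div_lt_one_div_of_lt (hn n) (by linarith)
  · rintro ⟨y, hy⟩ hlt
    rw [mem_ofPred_eq] at hlt
    rw [harmonicSet_eq] at hy
    obtain rfl | ⟨k, rfl⟩ := hy
    · have := hn n
      exact absurd hlt (by simp; positivity)
    · refine ⟨k, ?_, by simp [harmonicPoint]⟩
      have : (k : ℝ) + 1 < n + 2 := lt_of_one_div_lt_one_div (by positivity) hlt
      rw [mem_Iio]
      exact_mod_cast (by linarith : (k : ℝ) < n + 1)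

theorem isTotallyDisconnected_harmonicSet : IsTotallyDisconnected harmonicSet := by
  rw [harmonicSet_eq]
  exact ((countable_range _).insert 0).isTotallyDisconnected

theorem proposition6p1 :
    IsDoldSpace (UnreducedSuspension harmonicSet) ∧
    ¬ HasCWHomotopyType.{0, v} (UnreducedSuspension harmonicSet) ∧
    CompactSpace (UnreducedSuspension harmonicSet) ∧
    ¬ Module.Finite ℤ (integralH1 (UnreducedSuspension harmonicSet)) :=
  ⟨UnreducedSuspension.isDoldSpace,
    UnreducedSuspension.not_hasCWHomotopyType isTotallyDisconnected_harmonicSet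
      (y₀ := harmonicZero)
      (tendsto_nhdsWithin_iff.2 ⟨tendsto_harmonicPoint, .of_forall harmonicPoint_ne_zero⟩).neBot,
    inferInstance,
    UnreducedSuspension.not_finite_integralH1 harmonicZero harmonicPoint_injective
      harmonicPoint_ne_zero isClopen_singleton_harmonicPoint⟩
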